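/- Let $A=\{1,2,3,5\}$, and let $T_n(x)=\frac{1}{x+n}$ on $[0,1]$ for $n\in A$. Let $$X_A=\Big\{\lim_{n\to\infty}T_{a_1}\circ T_{a_2}\circ\cdots\circ T_{a_n}(0)\;:\; a_k\in A\text{ for all }k\ge 1\Big\}$$ be the limit set of this iterated function scheme (equivalently, the set of numbers $[0;a_1,a_2,\dots]$ whose infinite continued fraction has all its digits in $A$). Then its Hausdorff dimension satisfies $$\dim_H(X_A)=0.7709149399375\pm 1.5\cdot 10^{-12},\qquad\text{i.e.}\qquad \bigl|\dim_H(X_A)-0.7709149399375\bigr|\le 1.5\cdot 10^{-12}.$$ In particular, $\dim_H(X_A)>3-\sqrt5$. -/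

import Mathlib

/-!
For `s ≥ 0` let `(L f) x = ∑ a ∈ A, (x + a) ^ (-2 * s) * f (1 / (x + a))` be the transfer operator
of the branches. The diameter of the cylinder of a word `w` is comparable to `|(T_w)'|`, and
`L ^ n` sums `|(T_w)'| ^ s` against a function over the words of length `n`. If a positive `f`
satisfies `L f ≤ f`, these sums stay bounded, so the coverings by cylinders give `dim ≤ s`. If
`f ≤ L f`, the sums over finite families of cylinders that cover all codes are bounded below. The
points of the limit set in a given set have a common prefix whose cylinder is not much larger than
that set, so by compactness every covering has `s`-sum bounded below, which gives `dim ≥ s`.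

The test functions are positive combinations of the Möbius kernels
`(1 + β * (x - 1 / 2)) ^ (-2 * s)`. As the branches are Möbius maps, `L` sends such a combination
to another one, and two of them can be compared by comparing the moments `∑ c_j * β_j ^ k` that
occur in the binomial series in `x - 1 / 2`. The powers in the coefficients are enclosed through
rational bounds for logarithms, so that everything is checked in rational arithmetic. A single
choice of nodes and coefficients serves both bounds, because the eigenfunction barely changes
between the two exponents.
-/

open Filter Topology

/-- The inverse branch `T_n(x) = 1 / (x + n)` of the Gauss map; for `n ≥ 1` it maps `[0,1]`
into `[0,1]`. -/
noncomputable def gaussBranch (n : ℕ) (x : ℝ) : ℝ := 1 / (x + n)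

/-- The composition `T_{a 0} ∘ T_{a 1} ∘ ⋯ ∘ T_{a (n-1)}` of the maps of a family `T` along the
first `n` letters of the sequence `a` (the identity for `n = 0`). -/
def compAlong {ι : Type*} (T : ι → ℝ → ℝ) (a : ℕ → ι) : ℕ → ℝ → ℝ
  | 0 => id
  | n + 1 => compAlong T a n ∘ T (a n)

/-- The limit set `X_A` of the iterated function scheme `T_n(x) = 1 / (x + n)`, `n ∈ A`, on `[0,1]`:
all limits `lim_{n → ∞} (T_{a 0} ∘ ⋯ ∘ T_{a (n-1)}) 0` over sequences `a` of letters from `A`. -/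
def gaussLimitSet (A : Finset ℕ) : Set ℝ :=
  {x | ∃ a : ℕ → ℕ, (∀ k, a k ∈ A) ∧
    Tendsto (fun n => compAlong gaussBranch a n 0) atTop (𝓝 x)}

section Words

/-- The composition `T_{a₁} ∘ ⋯ ∘ T_{aₙ}` of the branches along the letters of a finite word. -/
noncomputable def wordMap : List ℕ → ℝ → ℝ
  | [] => id
  | a :: w => gaussBranch a ∘ wordMap w

/-- The square root of the absolute value of the derivative of `wordMap w`, defined through the
chain rule. -/
noncomputable def wordScale : List ℕ → ℝ → ℝ
  | [], _ => 1
  | a :: w, x => wordScale w x / (wordMap w x + a)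

@[simp] lemma wordMap_nil (x : ℝ) : wordMap [] x = x := rfl

@[simp] lemma wordMap_cons (a : ℕ) (w : List ℕ) (x : ℝ) :
    wordMap (a :: w) x = gaussBranch a (wordMap w x) := rfl

@[simp] lemma wordScale_nil (x : ℝ) : wordScale [] x = 1 := rfl

@[simp] lemma wordScale_cons (a : ℕ) (w : List ℕ) (x : ℝ) :
    wordScale (a :: w) x = wordScale w x / (wordMap w x + a) := rfl

lemma wordMap_append (w v : List ℕ) (x : ℝ) : wordMap (w ++ v) x = wordMap w (wordMap v x) := by
  induction w with
  | nil => rfl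
  | cons a w ih => simp [ih]

lemma wordScale_append (w v : List ℕ) (x : ℝ) :
    wordScale (w ++ v) x = wordScale w (wordMap v x) * wordScale v x := by
  induction w with
  | nil => simp
  | cons a w ih => simp [ih, wordMap_append, div_mul_eq_mul_div]

lemma gaussBranch_nonneg {x : ℝ} (hx : 0 ≤ x) (a : ℕ) : 0 ≤ gaussBranch a x :=
  one_div_nonneg.2 (by positivity)

lemma one_le_add_natCast {x : ℝ} (hx : 0 ≤ x) {a : ℕ} (ha : a ≠ 0) : 1 ≤ x + a :=
  le_add_of_nonneg_of_le hx (Nat.one_le_cast.2 (Nat.one_le_iff_ne_zero.2 ha))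

lemma gaussBranch_le_one {x : ℝ} (hx : 0 ≤ x) {a : ℕ} (ha : a ≠ 0) : gaussBranch a x ≤ 1 :=
  div_le_one_of_le₀ (one_le_add_natCast hx ha) (by positivity)

lemma gaussBranch_sub_gaussBranch {x y : ℝ} {a b : ℕ} (hx : x + a ≠ 0) (hy : y + b ≠ 0) :
    gaussBranch a x - gaussBranch b y = ((y + b) - (x + a)) / ((x + a) * (y + b)) := by
  rw [gaussBranch, gaussBranch, div_sub_div _ _ hx hy, one_mul, mul_one]

lemma wordMap_nonneg (w : List ℕ) {x : ℝ} (hx : 0 ≤ x) : 0 ≤ wordMap w x := by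
  induction w with
  | nil => exact hx
  | cons a w ih => exact gaussBranch_nonneg ih a

lemma wordMap_mem_Icc {w : List ℕ} (hw : 0 ∉ w) {x : ℝ} (hx : x ∈ Set.Icc (0 : ℝ) 1) :
    wordMap w x ∈ Set.Icc (0 : ℝ) 1 := by
  refine ⟨wordMap_nonneg w hx.1, ?_⟩
  cases w with
  | nil => exact hx.2
  | cons a w =>
    exact gaussBranch_le_one (wordMap_nonneg w hx.1) (List.ne_of_not_mem_cons hw).symm

lemma one_le_wordMap_add {a : ℕ} {w : List ℕ} (haw : 0 ∉ a :: w) {x : ℝ} (hx : 0 ≤ x) :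
    1 ≤ wordMap w x + a :=
  one_le_add_natCast (wordMap_nonneg w hx) (List.ne_of_not_mem_cons haw).symm

lemma wordScale_pos {w : List ℕ} (hw : 0 ∉ w) {x : ℝ} (hx : 0 ≤ x) : 0 < wordScale w x := by
  induction w with
  | nil => exact one_pos
  | cons a w ih =>
    exact div_pos (ih (List.not_mem_of_not_mem_cons hw))
      (one_pos.trans_le (one_le_wordMap_add hw hx))

/-- For Möbius maps the mean value theorem is an exact identity. -/
lemma abs_wordMap_sub {w : List ℕ} (hw : 0 ∉ w) {x y : ℝ} (hx : 0 ≤ x) (hy : 0 ≤ y) :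
    |wordMap w x - wordMap w y| = |x - y| * (wordScale w x * wordScale w y) := by
  induction w with
  | nil => simp
  | cons a w ih =>
    have hxa : 0 < wordMap w x + a := one_pos.trans_le (one_le_wordMap_add hw hx)
    have hya : 0 < wordMap w y + a := one_pos.trans_le (one_le_wordMap_add hw hy)
    rw [wordMap_cons, wordMap_cons, gaussBranch_sub_gaussBranch hxa.ne' hya.ne', abs_div,
      add_sub_add_right_eq_sub, abs_sub_comm, ih (List.not_mem_of_not_mem_cons hw),
      abs_of_pos (mul_pos hxa hya), wordScale_cons, wordScale_cons, div_mul_div_comm,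
      mul_div_assoc]

lemma exists_wordScale_eq_one_div {w : List ℕ} (hw : 0 ∉ w) :
    ∃ q q' : ℝ, 0 < q ∧ 0 ≤ q' ∧ q' ≤ q ∧ ∀ x, 0 ≤ x → wordScale w x = 1 / (q + q' * x) := by
  induction w using List.reverseRecOn with
  | nil => exact ⟨1, 0, by simp⟩
  | append_singleton w a ih =>
    rw [List.mem_append, not_or, List.mem_singleton] at hw
    obtain ⟨q, q', hq, hq', -, wordScale_eq⟩ := ih hw.1
    have one_le_a : (1 : ℝ) ≤ a := Nat.one_le_cast.2 (Nat.one_le_iff_ne_zero.2 (Ne.symm hw.2))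
    refine ⟨q * a + q', q, by positivity, hq.le, by nlinarith, fun x hx => ?_⟩
    have hxa : 0 < x + a := by linarith
    have denom_eq : q + q' * gaussBranch a x = (q * a + q' + q * x) / (x + a) := by
      rw [gaussBranch, mul_one_div, eq_div_iff hxa.ne', add_mul, div_mul_cancel₀ _ hxa.ne']
      ring
    rw [wordScale_append, wordMap_cons, wordMap_nil, wordScale_eq _ (gaussBranch_nonneg hx a),
      denom_eq, wordScale_cons, wordScale_nil, wordMap_nil, one_div_div, mul_one_div,
      div_right_comm, div_self hxa.ne']

lemma wordScale_le_two_mul {w : List ℕ} (hw : 0 ∉ w) {x y : ℝ} (hx : 0 ≤ x)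
    (hy : y ∈ Set.Icc (0 : ℝ) 1) : wordScale w x ≤ 2 * wordScale w y := by
  obtain ⟨q, q', hq, hq', hle, wordScale_eq⟩ := exists_wordScale_eq_one_div hw
  have mul_x_nonneg := mul_nonneg hq' hx
  have mul_y_nonneg := mul_nonneg hq' hy.1
  have mul_y_le := mul_le_mul_of_nonneg_left hy.2 hq'
  rw [wordScale_eq x hx, wordScale_eq y hy.1, mul_one_div,
    div_le_div_iff₀ (by linarith) (by linarith)]
  linarith

/-- A single branch with digit `1` does not contract near `0`, but two branches always do. -/
lemma wordScale_cons_cons_le {a b : ℕ} {w : List ℕ} (hw : 0 ∉ a :: b :: w) {x : ℝ} (hx : 0 ≤ x) :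
    wordScale (a :: b :: w) x ≤ wordScale w x / 2 := by
  have hbw := List.not_mem_of_not_mem_cons hw
  have one_le_b := one_le_wordMap_add hbw hx
  have one_le_a : (1 : ℝ) ≤ a :=
    Nat.one_le_cast.2 (Nat.one_le_iff_ne_zero.2 (List.ne_of_not_mem_cons hw).symm)
  have denom_eq : (wordMap w x + b) * (gaussBranch b (wordMap w x) + a) =
      1 + (wordMap w x + b) * a := by
    rw [gaussBranch, mul_add, mul_one_div_cancel (by linarith)]
  rw [wordScale_cons, wordScale_cons, wordMap_cons, div_div, denom_eq]
  have scale_pos := wordScale_pos (List.not_mem_of_not_mem_cons hbw) hx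
  gcongr
  nlinarith

lemma sq_wordScale_le {w : List ℕ} (hw : 0 ∉ w) {x : ℝ} (hx : 0 ≤ x) :
    wordScale w x ^ 2 ≤ 2 * (1 / 2) ^ w.length := by
  match w, hw with
  | [], _ => norm_num
  | [a], ha =>
    have inv_le_one : 1 / (x + a) ≤ 1 :=
      gaussBranch_le_one hx (by simpa [eq_comm] using ha)
    have inv_nonneg : 0 ≤ 1 / (x + a) := by positivity
    simpa using pow_le_one₀ inv_nonneg inv_le_one
  | a :: b :: w, hw =>
    have hw' := List.not_mem_of_not_mem_cons (List.not_mem_of_not_mem_cons hw)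
    have ih := sq_wordScale_le hw' hx
    calc wordScale (a :: b :: w) x ^ 2 ≤ (wordScale w x / 2) ^ 2 :=
          pow_le_pow_left₀ (wordScale_pos hw hx).le (wordScale_cons_cons_le hw hx) 2
      _ ≤ 2 * (1 / 2) ^ (w.length + 1 + 1) := by
          rw [div_pow, pow_succ _ (w.length + 1), pow_succ _ w.length]
          linarith

lemma abs_wordMap_sub_le {w : List ℕ} (hw : 0 ∉ w) {x y : ℝ} (hx : x ∈ Set.Icc (0 : ℝ) 1)
    (hy : y ∈ Set.Icc (0 : ℝ) 1) :
    |wordMap w x - wordMap w y| ≤ wordScale w x * wordScale w y := by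
  rw [abs_wordMap_sub hw hx.1 hy.1]
  exact mul_le_of_le_one_left
    (mul_pos (wordScale_pos hw hx.1) (wordScale_pos hw hy.1)).le
    (abs_le.2 ⟨by linarith [hx.1, hy.2], by linarith [hx.2, hy.1]⟩)

lemma abs_wordMap_sub_le_two_mul_half_pow {w : List ℕ} (hw : 0 ∉ w) {x y : ℝ}
    (hx : x ∈ Set.Icc (0 : ℝ) 1) (hy : y ∈ Set.Icc (0 : ℝ) 1) :
    |wordMap w x - wordMap w y| ≤ 2 * (1 / 2) ^ w.length := by
  linarith [abs_wordMap_sub_le hw hx hy, sq_wordScale_le hw hx.1, sq_wordScale_le hw hy.1,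
    two_mul_le_add_sq (wordScale w x) (wordScale w y)]

lemma abs_wordMap_sub_le_four_mul_sq {w : List ℕ} (hw : 0 ∉ w) {x y : ℝ}
    (hx : x ∈ Set.Icc (0 : ℝ) 1) (hy : y ∈ Set.Icc (0 : ℝ) 1) :
    |wordMap w x - wordMap w y| ≤ 4 * wordScale w 1 ^ 2 := by
  have one_mem : (1 : ℝ) ∈ Set.Icc (0 : ℝ) 1 := ⟨zero_le_one, le_rfl⟩
  calc |wordMap w x - wordMap w y| ≤ wordScale w x * wordScale w y := abs_wordMap_sub_le hw hx hy
    _ ≤ (2 * wordScale w 1) * (2 * wordScale w 1) :=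
        mul_le_mul (wordScale_le_two_mul hw hx.1 one_mem) (wordScale_le_two_mul hw hy.1 one_mem)
          (wordScale_pos hw hy.1).le (by linarith [wordScale_pos hw zero_le_one])
    _ = 4 * wordScale w 1 ^ 2 := by ring

lemma continuousOn_wordMap {w : List ℕ} (hw : 0 ∉ w) : ContinuousOn (wordMap w) (Set.Ici 0) := by
  induction w with
  | nil => exact continuousOn_id
  | cons a w ih =>
    exact continuousOn_const.div
      ((ih (List.not_mem_of_not_mem_cons hw)).add continuousOn_const) fun x hx =>
      (one_pos.trans_le (one_le_wordMap_add hw hx)).ne'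

end Words

section Coding

/-- The word formed by the first `n` letters of a sequence. -/
def seqPrefix {α : Type*} (a : ℕ → α) (n : ℕ) : List α := (List.range n).map a

@[simp] lemma length_seqPrefix {α : Type*} (a : ℕ → α) (n : ℕ) : (seqPrefix a n).length = n := by
  simp [seqPrefix]

lemma forall_mem_seqPrefix {α : Type*} {p : α → Prop} {a : ℕ → α} (ha : ∀ k, p (a k)) (n : ℕ) :
    ∀ b ∈ seqPrefix a n, p b := by
  simp [seqPrefix, ha]

lemma seqPrefix_succ {α : Type*} (a : ℕ → α) (n : ℕ) :
    seqPrefix a (n + 1) = seqPrefix a n ++ [a n] := by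
  simp [seqPrefix, List.range_succ]

lemma seqPrefix_add {α : Type*} (a : ℕ → α) (n m : ℕ) :
    seqPrefix a (n + m) = seqPrefix a n ++ seqPrefix (fun k => a (n + k)) m := by
  simp [seqPrefix, List.range_add, Function.comp_def]

lemma compAlong_eq_wordMap (a : ℕ → ℕ) (n : ℕ) (x : ℝ) :
    compAlong gaussBranch a n x = wordMap (seqPrefix a n) x := by
  induction n generalizing x with
  | zero => rfl
  | succ n ih =>
    rw [seqPrefix_succ, wordMap_append, ← ih]
    rfl

/-- The value `[0; a 0, a 1, …]` of an infinite continued fraction, as the limit of its convergents;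
a junk value if these do not converge. -/
noncomputable def gaussValue (a : ℕ → ℕ) : ℝ :=
  limUnder atTop fun n => compAlong gaussBranch a n 0

variable {a b : ℕ → ℕ}

lemma zero_notMem_seqPrefix (ha : ∀ k, a k ≠ 0) (n : ℕ) : 0 ∉ seqPrefix a n :=
  fun h => forall_mem_seqPrefix (p := (· ≠ 0)) ha n 0 h rfl

lemma compAlong_mem_Icc (ha : ∀ k, a k ≠ 0) (n : ℕ) :
    compAlong gaussBranch a n 0 ∈ Set.Icc (0 : ℝ) 1 := by
  rw [compAlong_eq_wordMap]
  exact wordMap_mem_Icc (zero_notMem_seqPrefix ha n) ⟨le_rfl, zero_le_one⟩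

lemma tendsto_gaussValue (ha : ∀ k, a k ≠ 0) :
    Tendsto (fun n => compAlong gaussBranch a n 0) atTop (𝓝 (gaussValue a)) := by
  refine CauchySeq.tendsto_limUnder (cauchySeq_of_le_geometric (1 / 2) 2 (by norm_num) fun n => ?_)
  have zero_mem : (0 : ℝ) ∈ Set.Icc (0 : ℝ) 1 := ⟨le_rfl, zero_le_one⟩
  have next_mem : wordMap [a n] 0 ∈ Set.Icc (0 : ℝ) 1 :=
    wordMap_mem_Icc (by simpa using (ha n).symm) zero_mem
  rw [compAlong_eq_wordMap, compAlong_eq_wordMap, seqPrefix_succ, wordMap_append, Real.dist_eq]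
  simpa using
    abs_wordMap_sub_le_two_mul_half_pow (zero_notMem_seqPrefix ha n) zero_mem next_mem

lemma gaussValue_mem_Icc (ha : ∀ k, a k ≠ 0) : gaussValue a ∈ Set.Icc (0 : ℝ) 1 :=
  isClosed_Icc.mem_of_tendsto (tendsto_gaussValue ha)
    (Eventually.of_forall fun n => compAlong_mem_Icc ha n)

lemma gaussValue_eq_wordMap (ha : ∀ k, a k ≠ 0) (n : ℕ) :
    gaussValue a = wordMap (seqPrefix a n) (gaussValue fun k => a (n + k)) := by
  have ha_shift : ∀ k, a (n + k) ≠ 0 := fun k => ha _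
  have tendsto_wordMap := ((continuousOn_wordMap (zero_notMem_seqPrefix ha n))
    _ (gaussValue_mem_Icc ha_shift).1).tendsto.comp (tendsto_nhdsWithin_iff.2
      ⟨tendsto_gaussValue ha_shift, Eventually.of_forall fun m => (compAlong_mem_Icc ha_shift m).1⟩)
  refine tendsto_nhds_unique ((tendsto_gaussValue ha).comp (tendsto_add_atTop_nat n))
    (tendsto_wordMap.congr fun m => ?_)
  simp only [Function.comp_apply, compAlong_eq_wordMap]
  rw [add_comm m n, seqPrefix_add, wordMap_append]

lemma gaussLimitSet_eq_image {A : Finset ℕ} (hA : 0 ∉ A) :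
    gaussLimitSet A = gaussValue '' {a | ∀ k, a k ∈ A} := by
  ext x
  refine exists_congr fun a => and_congr_right fun ha => ?_
  have tendsto_value := tendsto_gaussValue fun k => ne_of_mem_of_not_mem (ha k) hA
  exact ⟨fun hx => tendsto_nhds_unique tendsto_value hx, fun hx => hx ▸ tendsto_value⟩

lemma one_div_le_gaussValue (ha : ∀ k, a k ≠ 0) {M : ℕ} (ha₀ : a 0 ≤ M) :
    1 / ((M : ℝ) + 1) ≤ gaussValue a := by
  set u := gaussValue fun k => a (1 + k)
  have hu : u ∈ Set.Icc (0 : ℝ) 1 := gaussValue_mem_Icc fun k => ha _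
  have cast_le : (a 0 : ℝ) ≤ M := Nat.cast_le.2 ha₀
  calc 1 / ((M : ℝ) + 1) ≤ 1 / (u + a 0) := one_div_le_one_div_of_le
        (one_pos.trans_le (one_le_add_natCast hu.1 (ha 0))) (by linarith [hu.2])
    _ = gaussValue a := (gaussValue_eq_wordMap ha 1).symm

lemma le_abs_gaussBranch_sub {M i j : ℕ} (hij : i ≠ j) (hi : i ≤ M) (hj : j ≤ M) {u v : ℝ}
    (hu : u ∈ Set.Icc (1 / ((M : ℝ) + 1)) 1) (hv : v ∈ Set.Icc (1 / ((M : ℝ) + 1)) 1) :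
    1 / ((M : ℝ) + 1) ^ 3 ≤ |gaussBranch i u - gaussBranch j v| := by
  have lower_pos : 0 < 1 / ((M : ℝ) + 1) := by positivity
  have hui : 0 < u + i := add_pos_of_pos_of_nonneg (lower_pos.trans_le hu.1) i.cast_nonneg
  have hvj : 0 < v + j := add_pos_of_pos_of_nonneg (lower_pos.trans_le hv.1) j.cast_nonneg
  have hui_le : u + i ≤ M + 1 := by linarith [hu.2, (Nat.cast_le (α := ℝ)).2 hi]
  have hvj_le : v + j ≤ M + 1 := by linarith [hv.2, (Nat.cast_le (α := ℝ)).2 hj]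
  have one_le_digit_dist : (1 : ℝ) ≤ |(j : ℝ) - i| := by
    exact_mod_cast Int.one_le_abs (sub_ne_zero.2 (Nat.cast_injective.ne hij.symm))
  have tail_dist_le : |u - v| ≤ 1 - 1 / ((M : ℝ) + 1) :=
    abs_le.2 ⟨by linarith [hu.1, hv.2], by linarith [hu.2, hv.1]⟩
  have digit_dist_le : |(j : ℝ) - i| ≤ |v + j - (u + i)| + |u - v| :=
    (congrArg abs (by ring)).trans_le (abs_add_le (v + j - (u + i)) (u - v))
  rw [gaussBranch_sub_gaussBranch hui.ne' hvj.ne', abs_div, abs_of_pos (mul_pos hui hvj)]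
  calc 1 / ((M : ℝ) + 1) ^ 3 = 1 / (M + 1) / ((M + 1) * (M + 1)) := by field_simp
    _ ≤ |v + j - (u + i)| / ((u + i) * (v + j)) :=
      div_le_div₀ (abs_nonneg _) (by linarith) (mul_pos hui hvj)
        (mul_le_mul hui_le hvj_le hvj.le (by positivity))

/-- Points whose codes separate after `n` letters are at a distance comparable to the size of their
common cylinder. -/
lemma le_abs_gaussValue_sub {M : ℕ} (ha : ∀ k, a k ≠ 0) (hb : ∀ k, b k ≠ 0) (haM : ∀ k, a k ≤ M)
    (hbM : ∀ k, b k ≤ M) {n : ℕ} (hab : seqPrefix a n = seqPrefix b n) (hne : a n ≠ b n) :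
    1 / ((M : ℝ) + 1) ^ 3 * (wordScale (seqPrefix a n) 1 / 2) ^ 2 ≤
      |gaussValue a - gaussValue b| := by
  set u := gaussValue fun k => a (n + 1 + k)
  set v := gaussValue fun k => b (n + 1 + k)
  have hu : u ∈ Set.Icc (1 / ((M : ℝ) + 1)) 1 :=
    ⟨one_div_le_gaussValue (fun k => ha _) (haM _), (gaussValue_mem_Icc fun k => ha _).2⟩
  have hv : v ∈ Set.Icc (1 / ((M : ℝ) + 1)) 1 :=
    ⟨one_div_le_gaussValue (fun k => hb _) (hbM _), (gaussValue_mem_Icc fun k => hb _).2⟩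
  have hu₀ : 0 ≤ gaussBranch (a n) u := gaussBranch_nonneg (le_trans (by positivity) hu.1) _
  have hv₀ : 0 ≤ gaussBranch (b n) v := gaussBranch_nonneg (le_trans (by positivity) hv.1) _
  have hw := zero_notMem_seqPrefix ha n
  have scale_u := wordScale_le_two_mul hw zero_le_one (y := gaussBranch (a n) u)
    ⟨hu₀, gaussBranch_le_one (le_trans (by positivity) hu.1) (ha n)⟩
  have scale_v := wordScale_le_two_mul hw zero_le_one (y := gaussBranch (b n) v)
    ⟨hv₀, gaussBranch_le_one (le_trans (by positivity) hv.1) (hb n)⟩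
  have scale_pos := wordScale_pos hw zero_le_one
  rw [gaussValue_eq_wordMap ha (n + 1), gaussValue_eq_wordMap hb (n + 1), seqPrefix_succ,
    seqPrefix_succ, ← hab, wordMap_append, wordMap_append]
  simp only [wordMap_cons, wordMap_nil]
  rw [abs_wordMap_sub hw hu₀ hv₀]
  refine mul_le_mul (le_abs_gaussBranch_sub hne (haM n) (hbM n) hu hv) ?_ (sq_nonneg _)
    (abs_nonneg _)
  rw [sq]
  exact mul_le_mul (by linarith) (by linarith) (by linarith) (by linarith)

end Coding

section Transfer

/-- The transfer operator of the scheme `{T_a : a ∈ A}` with the weights `|T_a'| ^ (e / 2)`: the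
exponent `e` stands for `2 s` when `s` is the candidate dimension. -/
noncomputable def gaussTransfer (A : Finset ℕ) (e : ℝ) (f : ℝ → ℝ) (x : ℝ) : ℝ :=
  ∑ a ∈ A, (x + a) ^ (-e) * f (gaussBranch a x)

/-- The words of length `n` in the alphabet `A`. -/
def words (A : Finset ℕ) : ℕ → Finset (List ℕ)
  | 0 => {[]}
  | n + 1 => (A ×ˢ words A n).image fun p => p.1 :: p.2

/-- The summand indexed by the word `w` in the iterates of `gaussTransfer A e` on `f`, evaluated at
the point `1`. -/
noncomputable def wordWeight (e : ℝ) (f : ℝ → ℝ) (w : List ℕ) : ℝ :=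
  wordScale w 1 ^ e * f (wordMap w 1)

/-- The value at `1` of the `n`-th iterate of `gaussTransfer A e` on `f`, as a sum over words. -/
noncomputable def transferSum (A : Finset ℕ) (e : ℝ) (f : ℝ → ℝ) (n : ℕ) : ℝ :=
  ∑ w ∈ words A n, wordWeight e f w

variable {A : Finset ℕ} {e : ℝ} {f g : ℝ → ℝ} {n : ℕ} {w : List ℕ}

lemma mem_words : w ∈ words A n ↔ w.length = n ∧ ∀ a ∈ w, a ∈ A := by
  induction n generalizing w with
  | zero => cases w <;> simp [words]
  | succ n ih => cases w <;> simp [words, ih, and_left_comm]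

lemma zero_notMem_of_mem_words (hA : 0 ∉ A) (hw : w ∈ words A n) : 0 ∉ w :=
  fun h => hA ((mem_words.1 hw).2 0 h)

lemma wordWeight_mono (hw : 0 ∉ w) (hfg : ∀ x ∈ Set.Icc (0 : ℝ) 1, f x ≤ g x) :
    wordWeight e f w ≤ wordWeight e g w :=
  mul_le_mul_of_nonneg_left (hfg _ (wordMap_mem_Icc hw ⟨zero_le_one, le_rfl⟩))
    (Real.rpow_nonneg (wordScale_pos hw zero_le_one).le _)

lemma wordWeight_nonneg (hw : 0 ∉ w) (hf : ∀ x ∈ Set.Icc (0 : ℝ) 1, 0 ≤ f x) :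
    0 ≤ wordWeight e f w := by
  simpa [wordWeight] using wordWeight_mono (e := e) (f := 0) hw hf

@[simp] lemma transferSum_zero : transferSum A e f 0 = f 1 := by
  simp [transferSum, words, wordWeight]

lemma transferSum_succ (hA : 0 ∉ A) :
    transferSum A e f (n + 1) = transferSum A e (gaussTransfer A e f) n := by
  rw [transferSum, words, Finset.sum_image (by
    rintro ⟨a, v⟩ - ⟨b, u⟩ - h
    simpa using h), Finset.sum_product_right]
  refine Finset.sum_congr rfl fun w hw => ?_
  have hw0 := zero_notMem_of_mem_words hA hw
  rw [wordWeight, gaussTransfer, Finset.mul_sum]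
  refine Finset.sum_congr rfl fun a _ => ?_
  have denom_nonneg : 0 ≤ wordMap w 1 + a :=
    add_nonneg (wordMap_nonneg w zero_le_one) (Nat.cast_nonneg a)
  rw [wordWeight, wordScale_cons, wordMap_cons,
    Real.div_rpow (wordScale_pos hw0 zero_le_one).le denom_nonneg, Real.rpow_neg denom_nonneg,
    div_eq_mul_inv, mul_assoc]

lemma transferSum_mono (hA : 0 ∉ A) (hfg : ∀ x ∈ Set.Icc (0 : ℝ) 1, f x ≤ g x) (n : ℕ) :
    transferSum A e f n ≤ transferSum A e g n :=
  Finset.sum_le_sum fun _ hw => wordWeight_mono (zero_notMem_of_mem_words hA hw) hfg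

lemma antitone_transferSum (hA : 0 ∉ A)
    (hL : ∀ x ∈ Set.Icc (0 : ℝ) 1, gaussTransfer A e f x ≤ f x) : Antitone (transferSum A e f) :=
  antitone_nat_of_succ_le fun n => (transferSum_succ hA).trans_le (transferSum_mono hA hL n)

lemma monotone_transferSum (hA : 0 ∉ A)
    (hL : ∀ x ∈ Set.Icc (0 : ℝ) 1, f x ≤ gaussTransfer A e f x) : Monotone (transferSum A e f) :=
  monotone_nat_of_le_succ fun n => (transferSum_mono hA hL n).trans_eq (transferSum_succ hA).symm

end Transfer

section UpperBound

variable {A : Finset ℕ} {s : ℝ} {f : ℝ → ℝ}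

lemma sum_wordScale_rpow_le {e m : ℝ} (hA : 0 ∉ A) (hm : 0 < m)
    (hmf : ∀ x ∈ Set.Icc (0 : ℝ) 1, m ≤ f x)
    (hL : ∀ x ∈ Set.Icc (0 : ℝ) 1, gaussTransfer A e f x ≤ f x) (n : ℕ) :
    ∑ w ∈ words A n, wordScale w 1 ^ e ≤ f 1 / m := by
  rw [le_div_iff₀ hm, Finset.sum_mul]
  calc transferSum A e (fun _ => m) n ≤ transferSum A e f n := transferSum_mono hA hmf n
    _ ≤ transferSum A e f 0 := antitone_transferSum hA hL n.zero_le
    _ = f 1 := transferSum_zero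

lemma ediam_image_wordMap_le {w : List ℕ} {c : ℝ}
    (hc : ∀ x ∈ Set.Icc (0 : ℝ) 1, ∀ y ∈ Set.Icc (0 : ℝ) 1, |wordMap w x - wordMap w y| ≤ c) :
    Metric.ediam (wordMap w '' Set.Icc 0 1) ≤ ENNReal.ofReal c := by
  refine Metric.ediam_le ?_
  rintro _ ⟨x, hx, rfl⟩ _ ⟨y, hy, rfl⟩
  rw [edist_dist, Real.dist_eq]
  exact ENNReal.ofReal_le_ofReal (hc x hx y hy)

lemma gaussLimitSet_subset_iUnion_wordMap (hA : 0 ∉ A) (n : ℕ) :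
    gaussLimitSet A ⊆ ⋃ w : words A n, wordMap w '' Set.Icc 0 1 := by
  rw [gaussLimitSet_eq_image hA]
  rintro _ ⟨a, ha : ∀ k, a k ∈ A, rfl⟩
  have ha0 : ∀ k, a k ≠ 0 := fun k => ne_of_mem_of_not_mem (ha k) hA
  have prefix_mem : seqPrefix a n ∈ words A n :=
    mem_words.2 ⟨length_seqPrefix a n, forall_mem_seqPrefix (p := (· ∈ A)) ha n⟩
  exact Set.mem_iUnion.2 ⟨⟨_, prefix_mem⟩, _, gaussValue_mem_Icc fun k => ha0 (n + k),
    (gaussValue_eq_wordMap ha0 n).symm⟩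

lemma sum_ediam_image_wordMap_rpow_le {m : ℝ} (hA : 0 ∉ A) (hs : 0 ≤ s) (hm : 0 < m)
    (hmf : ∀ x ∈ Set.Icc (0 : ℝ) 1, m ≤ f x)
    (hL : ∀ x ∈ Set.Icc (0 : ℝ) 1, gaussTransfer A (2 * s) f x ≤ f x) (n : ℕ) :
    ∑ w ∈ words A n, Metric.ediam (wordMap w '' Set.Icc 0 1) ^ s ≤
      ENNReal.ofReal (4 ^ s * (f 1 / m)) := by
  have scale_pos : ∀ w ∈ words A n, 0 < wordScale w 1 := fun w hw =>
    wordScale_pos (zero_notMem_of_mem_words hA hw) zero_le_one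
  calc ∑ w ∈ words A n, Metric.ediam (wordMap w '' Set.Icc 0 1) ^ s
      ≤ ∑ w ∈ words A n, ENNReal.ofReal (4 ^ s * wordScale w 1 ^ (2 * s)) := by
        refine Finset.sum_le_sum fun w hw => ?_
        have ediam_le := ediam_image_wordMap_le fun x hx y hy =>
          abs_wordMap_sub_le_four_mul_sq (zero_notMem_of_mem_words hA hw) hx hy
        refine (ENNReal.rpow_le_rpow ediam_le hs).trans_eq ?_
        rw [ENNReal.ofReal_rpow_of_nonneg (by positivity) hs,
          Real.mul_rpow (by norm_num) (by positivity), Real.rpow_mul (scale_pos w hw).le,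
          Real.rpow_two]
    _ = ENNReal.ofReal (4 ^ s * ∑ w ∈ words A n, wordScale w 1 ^ (2 * s)) := by
        rw [Finset.mul_sum, ENNReal.ofReal_sum_of_nonneg fun w hw =>
          mul_nonneg (by positivity) (Real.rpow_nonneg (scale_pos w hw).le _)]
    _ ≤ ENNReal.ofReal (4 ^ s * (f 1 / m)) := by
        gcongr
        exact sum_wordScale_rpow_le hA hm hmf hL n

lemma hausdorffMeasure_gaussLimitSet_le {m : ℝ} (hA : 0 ∉ A) (hs : 0 ≤ s) (hm : 0 < m)
    (hmf : ∀ x ∈ Set.Icc (0 : ℝ) 1, m ≤ f x)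
    (hL : ∀ x ∈ Set.Icc (0 : ℝ) 1, gaussTransfer A (2 * s) f x ≤ f x) :
    MeasureTheory.Measure.hausdorffMeasure s (gaussLimitSet A) ≤
      ENNReal.ofReal (4 ^ s * (f 1 / m)) := by
  have mesh_tendsto :
      Tendsto (fun n : ℕ => ENNReal.ofReal (2 * (1 / 2) ^ n)) atTop (𝓝 0) := by
    simpa using ENNReal.tendsto_ofReal ((tendsto_pow_atTop_nhds_zero_of_lt_one
      (r := (1 / 2 : ℝ)) (by norm_num) (by norm_num)).const_mul 2)
  have ediam_le : ∀ n (w : words A n),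
      Metric.ediam (wordMap w '' Set.Icc 0 1) ≤ ENNReal.ofReal (2 * (1 / 2) ^ n) := fun n w =>
    ediam_image_wordMap_le fun x hx y hy => by
      simpa only [(mem_words.1 w.2).1] using
        abs_wordMap_sub_le_two_mul_half_pow (zero_notMem_of_mem_words hA w.2) hx hy
  calc MeasureTheory.Measure.hausdorffMeasure s (gaussLimitSet A)
      ≤ liminf (fun n => ∑ w : words A n, Metric.ediam (wordMap w '' Set.Icc 0 1) ^ s) atTop :=
        MeasureTheory.Measure.hausdorffMeasure_le_liminf_sum s _ _ mesh_tendsto _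
          (Eventually.of_forall ediam_le)
          (Eventually.of_forall (gaussLimitSet_subset_iUnion_wordMap hA))
    _ ≤ liminf (fun _ : ℕ => ENNReal.ofReal (4 ^ s * (f 1 / m))) atTop :=
        liminf_le_liminf (Eventually.of_forall fun n => by
          rw [Finset.sum_coe_sort (words A n) fun w =>
            Metric.ediam (wordMap w '' Set.Icc 0 1) ^ s]
          exact sum_ediam_image_wordMap_rpow_le hA hs hm hmf hL n)
    _ = ENNReal.ofReal (4 ^ s * (f 1 / m)) := liminf_const _

theorem dimH_gaussLimitSet_le (hA : 0 ∉ A) (hs : 0 ≤ s) (hf : ContinuousOn f (Set.Icc 0 1))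
    (hpos : ∀ x ∈ Set.Icc (0 : ℝ) 1, 0 < f x)
    (hL : ∀ x ∈ Set.Icc (0 : ℝ) 1, gaussTransfer A (2 * s) f x ≤ f x) :
    dimH (gaussLimitSet A) ≤ ENNReal.ofReal s := by
  obtain ⟨x₀, hx₀, isMin⟩ := isCompact_Icc.exists_isMinOn (Set.nonempty_Icc.2 zero_le_one) hf
  have measure_le := hausdorffMeasure_gaussLimitSet_le hA hs (hpos x₀ hx₀)
    (fun x hx => isMin hx) hL
  have dimH_le := dimH_le_of_hausdorffMeasure_ne_top (d := ⟨s, hs⟩)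
    (ne_top_of_le_ne_top ENNReal.ofReal_ne_top measure_le)
  rwa [ENNReal.ofReal, Real.toNNReal_of_nonneg hs]

end UpperBound

section WeightBounds

variable {A : Finset ℕ} {e m K : ℝ} {f : ℝ → ℝ}

/-- The factor `2 ^ e` is the distortion of the scales, `K / m` the oscillation of `f`. -/
lemma wordWeight_append_le (he : 0 ≤ e) (hm : 0 < m)
    (hf : ∀ x ∈ Set.Icc (0 : ℝ) 1, f x ∈ Set.Icc m K) {w v : List ℕ} (hw : 0 ∉ w) (hv : 0 ∉ v) :
    wordWeight e f (w ++ v) ≤ 2 ^ e * (K / m) * wordScale w 1 ^ e * wordWeight e f v := by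
  have one_mem : (1 : ℝ) ∈ Set.Icc (0 : ℝ) 1 := ⟨zero_le_one, le_rfl⟩
  have v_mem := wordMap_mem_Icc hv one_mem
  have f_wv_mem := hf _ (wordMap_mem_Icc hw v_mem)
  have scale_w_pos := wordScale_pos hw zero_le_one
  have scale_w_pos' := wordScale_pos hw v_mem.1
  have scale_v_pos := wordScale_pos hv zero_le_one
  have scale_le : wordScale w (wordMap v 1) ^ e ≤ 2 ^ e * wordScale w 1 ^ e := by
    rw [← Real.mul_rpow two_pos.le scale_w_pos.le]
    exact Real.rpow_le_rpow scale_w_pos'.le (wordScale_le_two_mul hw v_mem.1 one_mem) he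
  have f_le : f (wordMap w (wordMap v 1)) ≤ K / m * f (wordMap v 1) := by
    rw [div_mul_eq_mul_div, le_div_iff₀ hm]
    exact mul_le_mul f_wv_mem.2 (hf _ v_mem).1 hm.le ((hm.le.trans f_wv_mem.1).trans f_wv_mem.2)
  have f_nonneg := hm.le.trans f_wv_mem.1
  rw [wordWeight, wordWeight, wordScale_append, wordMap_append,
    Real.mul_rpow scale_w_pos'.le scale_v_pos.le]
  calc wordScale w (wordMap v 1) ^ e * wordScale v 1 ^ e * f (wordMap w (wordMap v 1))
      ≤ (2 ^ e * wordScale w 1 ^ e) * wordScale v 1 ^ e * (K / m * f (wordMap v 1)) := by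
        gcongr
    _ = 2 ^ e * (K / m) * wordScale w 1 ^ e * (wordScale v 1 ^ e * f (wordMap v 1)) := by ring

lemma sum_wordWeight_append_le (hA : 0 ∉ A) (he : 0 ≤ e) (hm : 0 < m)
    (hf : ∀ x ∈ Set.Icc (0 : ℝ) 1, f x ∈ Set.Icc m K) {w : List ℕ} (hw : 0 ∉ w) (n : ℕ) :
    ∑ v ∈ words A n, wordWeight e f (w ++ v) ≤
      2 ^ e * (K / m) * wordScale w 1 ^ e * transferSum A e f n := by
  rw [transferSum, Finset.mul_sum]
  exact Finset.sum_le_sum fun v hv =>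
    wordWeight_append_le he hm hf hw (zero_notMem_of_mem_words hA hv)

/-- The hypothesis `hcov` says that the cylinders of the words `w i` cover all sequences in `A`. -/
lemma exists_mem_words_append_eq (hne : A.Nonempty) {ι : Type*} {I : Finset ι} {w : ι → List ℕ}
    (hcov : ∀ a : ℕ → ℕ, (∀ k, a k ∈ A) → ∃ i ∈ I, seqPrefix a (w i).length = w i) {n : ℕ}
    (hn : ∀ i ∈ I, (w i).length ≤ n) {u : List ℕ} (hu : u ∈ words A n) :
    ∃ i ∈ I, ∃ v ∈ words A (n - (w i).length), w i ++ v = u := by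
  obtain ⟨a₀, ha₀⟩ := hne
  obtain ⟨u_length, u_letters⟩ := mem_words.1 hu
  have letters_mem : ∀ k, u.getD k a₀ ∈ A := fun k => by
    by_cases hk : k < u.length
    · rw [List.getD_eq_getElem _ _ hk]
      exact u_letters _ (List.getElem_mem hk)
    · rwa [List.getD_eq_default _ _ (not_lt.1 hk)]
  obtain ⟨i, hi, prefix_eq⟩ := hcov _ letters_mem
  have take_eq : u.take (w i).length = w i := by
    refine Eq.trans ?_ prefix_eq
    refine List.ext_getElem (by simp [u_length, hn i hi]) fun k hk _ => ?_
    have hk' : k < u.length := hk.trans_le (List.length_take_le' _ _)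
    simp [seqPrefix, hk']
  refine ⟨i, hi, u.drop (w i).length, mem_words.2
    ⟨by rw [List.length_drop, u_length], fun a ha => u_letters a (List.mem_of_mem_drop ha)⟩, ?_⟩
  conv_rhs => rw [← List.take_append_drop (w i).length u, take_eq]

lemma transferSum_le_sum_append (hA : 0 ∉ A) (hne : A.Nonempty)
    (hf : ∀ x ∈ Set.Icc (0 : ℝ) 1, 0 ≤ f x) {ι : Type*} {I : Finset ι} {w : ι → List ℕ}
    (hw : ∀ i, 0 ∉ w i)
    (hcov : ∀ a : ℕ → ℕ, (∀ k, a k ∈ A) → ∃ i ∈ I, seqPrefix a (w i).length = w i) {n : ℕ}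
    (hn : ∀ i ∈ I, (w i).length ≤ n) :
    transferSum A e f n ≤
      ∑ i ∈ I, ∑ v ∈ words A (n - (w i).length), wordWeight e f (w i ++ v) := by
  classical
  have : Nonempty ι :=
    let ⟨a₀, ha₀⟩ := hne
    let ⟨i, _⟩ := hcov (fun _ => a₀) fun _ => ha₀
    ⟨i⟩
  choose! i hi v hv append_eq using fun u (hu : u ∈ words A n) =>
    exists_mem_words_append_eq hne hcov hn hu
  rw [transferSum, ← Finset.sum_fiberwise_of_maps_to hi]
  refine Finset.sum_le_sum fun j _ => ?_
  rw [← Finset.sum_image fun _ _ _ _ h => List.append_cancel_left h]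
  refine Finset.sum_le_sum_of_subset_of_nonneg (fun u hu => ?_) fun u hu _ => ?_
  · obtain ⟨u_mem, rfl⟩ := Finset.mem_filter.1 hu
    exact Finset.mem_image.2 ⟨v u, hv u u_mem, append_eq u u_mem⟩
  · obtain ⟨v, hv, rfl⟩ := Finset.mem_image.1 hu
    exact wordWeight_nonneg
      (by simpa using ⟨hw j, zero_notMem_of_mem_words hA hv⟩) hf

lemma one_le_mul_sum_wordScale_rpow (hA : 0 ∉ A) (he : 0 ≤ e) (hm : 0 < m)
    (hf : ∀ x ∈ Set.Icc (0 : ℝ) 1, f x ∈ Set.Icc m K)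
    (hL : ∀ x ∈ Set.Icc (0 : ℝ) 1, f x ≤ gaussTransfer A e f x)
    {ι : Type*} {I : Finset ι} {w : ι → List ℕ} (hw : ∀ i, 0 ∉ w i)
    (hcov : ∀ a : ℕ → ℕ, (∀ k, a k ∈ A) → ∃ i ∈ I, seqPrefix a (w i).length = w i) :
    1 ≤ 2 ^ e * (K / m) * ∑ i ∈ I, wordScale (w i) 1 ^ e := by
  have monotone_sum := monotone_transferSum hA hL
  have one_mem : (1 : ℝ) ∈ Set.Icc (0 : ℝ) 1 := ⟨zero_le_one, le_rfl⟩
  have f_one_mem := hf 1 one_mem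
  have hne : A.Nonempty := Finset.nonempty_of_sum_ne_zero
    (hm.trans_le (f_one_mem.1.trans (hL 1 one_mem))).ne'
  have K_nonneg : 0 ≤ K := (hm.le.trans f_one_mem.1).trans f_one_mem.2
  set n := I.sup fun i => (w i).length
  have sum_pos : 0 < transferSum A e f n := by
    refine lt_of_lt_of_le ?_ (monotone_sum n.zero_le)
    exact transferSum_zero (f := f) ▸ hm.trans_le f_one_mem.1
  refine le_of_mul_le_mul_right ?_ sum_pos
  calc 1 * transferSum A e f n
      ≤ ∑ i ∈ I, ∑ v ∈ words A (n - (w i).length), wordWeight e f (w i ++ v) := by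
        rw [one_mul]
        exact transferSum_le_sum_append hA hne (fun x hx => hm.le.trans (hf x hx).1) hw hcov
          fun i hi => Finset.le_sup (f := fun i => (w i).length) hi
    _ ≤ ∑ i ∈ I, 2 ^ e * (K / m) * wordScale (w i) 1 ^ e * transferSum A e f n := by
        refine Finset.sum_le_sum fun i _ =>
          (sum_wordWeight_append_le hA he hm hf (hw i) _).trans ?_
        have scale_nonneg := (wordScale_pos (hw i) zero_le_one).le
        gcongr
        exact monotone_sum (Nat.sub_le _ _)
    _ = 2 ^ e * (K / m) * (∑ i ∈ I, wordScale (w i) 1 ^ e) * transferSum A e f n := by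
        rw [Finset.mul_sum, Finset.sum_mul]

end WeightBounds

section LowerBound

lemma seqPrefix_agree_or_exists_branching {α : Type*} (S : Set (ℕ → α)) (n : ℕ) :
    (∀ a ∈ S, ∀ b ∈ S, seqPrefix a n = seqPrefix b n) ∨
      ∃ m, (∀ a ∈ S, ∀ b ∈ S, seqPrefix a m = seqPrefix b m) ∧ ∃ a ∈ S, ∃ b ∈ S, a m ≠ b m := by
  induction n with
  | zero => exact Or.inl fun _ _ _ _ => rfl
  | succ n ih =>
    refine ih.elim (fun agree => ?_) Or.inr
    by_cases next : ∀ a ∈ S, ∀ b ∈ S, a n = b n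
    · exact Or.inl fun a ha b hb => by
        rw [seqPrefix_succ, seqPrefix_succ, agree a ha b hb, next a ha b hb]
    · push Not at next
      exact Or.inr ⟨n, agree, next⟩

variable {A : Finset ℕ}

lemma exists_common_prefix (hA : 0 ∉ A) :
    ∃ κ : ℝ, 0 < κ ∧ ∀ (t : Set ℝ) (r : ℝ), 0 < r → Metric.ediam t ≤ ENNReal.ofReal r →
      ∃ w : List ℕ, 0 ∉ w ∧ κ * wordScale w 1 ^ 2 ≤ r ∧
        ∀ a : ℕ → ℕ, (∀ k, a k ∈ A) → gaussValue a ∈ t → seqPrefix a w.length = w := by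
  set M := A.sup id
  have le_M : ∀ b ∈ A, b ≤ M := fun b hb => Finset.le_sup (f := id) hb
  have ne_zero : ∀ a : ℕ → ℕ, (∀ k, a k ∈ A) → ∀ k, a k ≠ 0 :=
    fun a ha k => ne_of_mem_of_not_mem (ha k) hA
  refine ⟨1 / ((M : ℝ) + 1) ^ 3 / 4, by positivity, fun t r hr ediam_le => ?_⟩
  set S : Set (ℕ → ℕ) := {a | (∀ k, a k ∈ A) ∧ gaussValue a ∈ t}
  obtain ⟨n, hn⟩ := exists_pow_lt_of_lt_one (show 0 < r / (2 * (1 / ((M : ℝ) + 1) ^ 3 / 4)) by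
    positivity) (by norm_num : (1 / 2 : ℝ) < 1)
  rcases seqPrefix_agree_or_exists_branching S n with agree | ⟨m, agree, a, ha, b, hb, hab⟩
  · obtain ⟨a, ha, prefix_eq⟩ :
        ∃ a : ℕ → ℕ, (∀ k, a k ≠ 0) ∧ ∀ b ∈ S, seqPrefix b n = seqPrefix a n := by
      rcases S.eq_empty_or_nonempty with hS | ⟨a, ha⟩
      · exact ⟨fun _ => 1, fun _ => one_ne_zero, by simp [hS]⟩
      · exact ⟨a, ne_zero a ha.1, fun b hb => agree b hb a ha⟩
    have hw := zero_notMem_seqPrefix ha n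
    have scale_le := sq_wordScale_le hw zero_le_one
    rw [length_seqPrefix] at scale_le
    rw [lt_div_iff₀ (by positivity)] at hn
    refine ⟨seqPrefix a n, hw, ?_, fun b hb hbt => ?_⟩
    · have scaled_le := mul_le_mul_of_nonneg_left scale_le
        (show 0 ≤ 1 / ((M : ℝ) + 1) ^ 3 / 4 by positivity)
      linarith
    · rw [length_seqPrefix, prefix_eq b ⟨hb, hbt⟩]
  · refine ⟨seqPrefix a m, zero_notMem_seqPrefix (ne_zero a ha.1) m, ?_, fun c hc hct => ?_⟩
    · have separated := le_abs_gaussValue_sub (ne_zero a ha.1) (ne_zero b hb.1)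
        (fun k => le_M _ (ha.1 k)) (fun k => le_M _ (hb.1 k)) (agree a ha b hb) hab
      have dist_le : |gaussValue a - gaussValue b| ≤ r := by
        rw [← Real.dist_eq, ← ENNReal.ofReal_le_ofReal_iff hr.le, ← edist_dist]
        exact (Metric.edist_le_ediam_of_mem ha.2 hb.2).trans ediam_le
      linarith
    · rw [length_seqPrefix, agree c ⟨hc, hct⟩ a ha]

lemma isOpen_setOf_seqPrefix_eq (w : List ℕ) : IsOpen {a : ℕ → ℕ | seqPrefix a w.length = w} := by
  have inter_eq :
      {a : ℕ → ℕ | seqPrefix a w.length = w} = ⋂ i : Fin w.length, {a | a i = w[i]} := by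
    ext a
    simp [seqPrefix, List.ext_getElem_iff, Fin.forall_iff]
  rw [inter_eq]
  exact isOpen_iInter_of_finite fun i =>
    (isOpen_discrete {w[i]}).preimage (continuous_apply (A := fun _ => ℕ) (i : ℕ))

lemma exists_finset_forall_seqPrefix_eq {ι : Type*} {w : ι → List ℕ}
    (hw : ∀ a : ℕ → ℕ, (∀ k, a k ∈ A) → ∃ i, seqPrefix a (w i).length = w i) :
    ∃ I : Finset ι, ∀ a : ℕ → ℕ, (∀ k, a k ∈ A) → ∃ i ∈ I, seqPrefix a (w i).length = w i := by
  have compact : IsCompact (Set.univ.pi fun _ : ℕ => (A : Set ℕ)) :=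
    isCompact_univ_pi fun _ => A.finite_toSet.isCompact
  obtain ⟨I, hI⟩ := compact.elim_finite_subcover _ (fun i => isOpen_setOf_seqPrefix_eq (w i))
    fun a ha => Set.mem_iUnion.2 (hw a fun k => ha k trivial)
  exact ⟨I, fun a ha => by simpa using hI fun k _ => ha k⟩

/-- Covers by sets of diameter at most `r i` with `r i > 0` suffice: sets that are empty or reduced
to a point can be given a positive radius at an arbitrarily small cost. -/
lemma le_hausdorffMeasure_of_forall_cover {X : Type*} [EMetricSpace X] [MeasurableSpace X]
    [BorelSpace X] {s : ℝ} (hs : 0 < s) {E : Set X} {c : ENNReal}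
    (h : ∀ (t : ℕ → Set X) (r : ℕ → NNReal), E ⊆ ⋃ i, t i → (∀ i, 0 < r i) →
      (∀ i, Metric.ediam (t i) ≤ r i) → c ≤ ∑' i, (r i : ENNReal) ^ s) :
    c ≤ MeasureTheory.Measure.hausdorffMeasure s E := by
  by_contra! measure_lt
  rw [MeasureTheory.Measure.hausdorffMeasure_apply] at measure_lt
  have cover_lt := (le_iSup₂ (f := fun (r : ENNReal) (_ : 0 < r) =>
    ⨅ (t : ℕ → Set X) (_ : E ⊆ ⋃ n, t n) (_ : ∀ n, Metric.ediam (t n) ≤ r),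
      ∑' n, ⨆ _ : (t n).Nonempty, Metric.ediam (t n) ^ s) ⊤ (by simp)).trans_lt measure_lt
  simp only [iInf_lt_iff] at cover_lt
  obtain ⟨t, ht, -, sum_lt⟩ := cover_lt
  set d : ℕ → ENNReal := fun i => ⨆ _ : (t i).Nonempty, Metric.ediam (t i) ^ s
  obtain ⟨ε, ε_pos, ε_sum_lt⟩ :=
    ENNReal.exists_pos_sum_of_countable (tsub_pos_of_lt sum_lt).ne' ℕ
  have total_lt : ∑' i, (d i + ε i) < c := by
    rw [ENNReal.tsum_add, add_comm]
    exact lt_tsub_iff_right.1 ε_sum_lt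
  have term_ne_top : ∀ i, d i + ε i ≠ ⊤ :=
    ENNReal.ne_top_of_tsum_ne_top total_lt.ne_top
  set r : ℕ → NNReal := fun i => (d i + ε i).toNNReal ^ (1 / s)
  have r_rpow : ∀ i, (r i : ENNReal) ^ s = d i + ε i := fun i => by
    rw [ENNReal.coe_rpow_of_nonneg _ (by positivity), ENNReal.coe_toNNReal (term_ne_top i),
      ← ENNReal.rpow_mul, one_div_mul_cancel hs.ne', ENNReal.rpow_one]
  refine total_lt.not_ge ((h t r ht (fun i => ?_) fun i => ?_).trans_eq (tsum_congr r_rpow))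
  · refine NNReal.rpow_pos (ENNReal.toNNReal_pos ?_ (term_ne_top i))
    simp [(ε_pos i).ne']
  · rw [← ENNReal.rpow_le_rpow_iff hs, r_rpow]
    refine le_add_right ?_
    rcases (t i).eq_empty_or_nonempty with hti | hti
    · simp [hti, hs]
    · exact le_iSup (fun _ : (t i).Nonempty => Metric.ediam (t i) ^ s) hti

lemma ofReal_sum_rpow_le_tsum {ι : Type*} {s : ℝ} (hs : 0 ≤ s) (r : ι → NNReal) (I : Finset ι) :
    ENNReal.ofReal (∑ i ∈ I, (r i : ℝ) ^ s) ≤ ∑' i, (r i : ENNReal) ^ s := by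
  rw [ENNReal.ofReal_sum_of_nonneg fun i _ => by positivity]
  refine (Finset.sum_congr rfl fun i _ => ?_).trans_le (ENNReal.sum_le_tsum I)
  rw [← ENNReal.ofReal_rpow_of_nonneg (r i).coe_nonneg hs, ENNReal.ofReal_coe_nnreal]

lemma hausdorffMeasure_gaussLimitSet_ne_zero {s m K : ℝ} {f : ℝ → ℝ} (hA : 0 ∉ A)
    (hs : 0 < s) (hm : 0 < m)
    (hf : ∀ x ∈ Set.Icc (0 : ℝ) 1, f x ∈ Set.Icc m K)
    (hL : ∀ x ∈ Set.Icc (0 : ℝ) 1, f x ≤ gaussTransfer A (2 * s) f x) :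
    MeasureTheory.Measure.hausdorffMeasure s (gaussLimitSet A) ≠ 0 := by
  obtain ⟨κ, κ_pos, common_prefix⟩ := exists_common_prefix hA
  have f_one_mem := hf 1 ⟨zero_le_one, le_rfl⟩
  have K_pos : 0 < K := (hm.trans_le f_one_mem.1).trans_le f_one_mem.2
  set C : ℝ := 2 ^ (2 * s) * (K / m)
  have C_pos : 0 < C := by positivity
  suffices ENNReal.ofReal (κ ^ s / C) ≤
      MeasureTheory.Measure.hausdorffMeasure s (gaussLimitSet A) from
    ((ENNReal.ofReal_pos.2 (by positivity)).trans_le this).ne'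
  refine le_hausdorffMeasure_of_forall_cover hs fun t r ht r_pos ediam_le => ?_
  choose w hw scale_le prefix_eq using fun i =>
    common_prefix (t i) (r i) (r_pos i) (by simpa using ediam_le i)
  rw [gaussLimitSet_eq_image hA, Set.image_subset_iff] at ht
  obtain ⟨I, hI⟩ := exists_finset_forall_seqPrefix_eq (A := A) (w := w) fun a ha => by
    obtain ⟨i, hi⟩ := Set.mem_iUnion.1 (ht ha)
    exact ⟨i, prefix_eq i a ha hi⟩
  have scale_rpow_le : ∀ i, κ ^ s * wordScale (w i) 1 ^ (2 * s) ≤ (r i : ℝ) ^ s := fun i => by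
    rw [Real.rpow_mul (wordScale_pos (hw i) zero_le_one).le, Real.rpow_two,
      ← Real.mul_rpow κ_pos.le (sq_nonneg _)]
    exact Real.rpow_le_rpow (by positivity) (scale_le i) hs.le
  have one_le := one_le_mul_sum_wordScale_rpow hA (by positivity) hm hf hL hw hI
  calc ENNReal.ofReal (κ ^ s / C)
      ≤ ENNReal.ofReal (∑ i ∈ I, (r i : ℝ) ^ s) := by
        refine ENNReal.ofReal_le_ofReal ?_
        calc κ ^ s / C ≤ κ ^ s * ∑ i ∈ I, wordScale (w i) 1 ^ (2 * s) := by
              rw [div_eq_mul_inv]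
              gcongr
              rwa [inv_le_iff_one_le_mul₀' C_pos]
          _ ≤ ∑ i ∈ I, (r i : ℝ) ^ s := by
              rw [Finset.mul_sum]
              exact Finset.sum_le_sum fun i _ => scale_rpow_le i
    _ ≤ ∑' i, (r i : ENNReal) ^ s := ofReal_sum_rpow_le_tsum hs.le r I

theorem le_dimH_gaussLimitSet {s : ℝ} {f : ℝ → ℝ} (hA : 0 ∉ A)
    (hf : ContinuousOn f (Set.Icc 0 1)) (hpos : ∀ x ∈ Set.Icc (0 : ℝ) 1, 0 < f x)
    (hL : ∀ x ∈ Set.Icc (0 : ℝ) 1, f x ≤ gaussTransfer A (2 * s) f x) :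
    ENNReal.ofReal s ≤ dimH (gaussLimitSet A) := by
  rcases le_or_gt s 0 with hs | hs
  · simp [ENNReal.ofReal_of_nonpos hs]
  have nonempty_Icc : (Set.Icc (0 : ℝ) 1).Nonempty := Set.nonempty_Icc.2 zero_le_one
  obtain ⟨x₀, hx₀, isMin⟩ := isCompact_Icc.exists_isMinOn nonempty_Icc hf
  obtain ⟨x₁, -, isMax⟩ := isCompact_Icc.exists_isMaxOn nonempty_Icc hf
  have le_dimH := le_dimH_of_hausdorffMeasure_ne_zero (d := ⟨s, hs.le⟩)
    (hausdorffMeasure_gaussLimitSet_ne_zero hA hs (hpos x₀ hx₀)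
      (fun x hx => ⟨isMin hx, isMax hx⟩) hL)
  rwa [ENNReal.ofReal, Real.toNNReal_of_nonneg hs.le]

end LowerBound

section Moments

lemma abs_choose_neg_le {e : ℝ} (he₀ : 0 ≤ e) (he₂ : e ≤ 2) (k : ℕ) :
    |Ring.choose (-e) k| ≤ k + 1 := by
  induction k with
  | zero => simp
  | succ k ih =>
    have choose_succ :
        Ring.choose (-e) (k + 1) * (k + 1) = Ring.choose (-e) k * (-e - k) := by
      have hk : ((k.factorial : ℕ) : ℝ) ≠ 0 := by exact_mod_cast k.factorial_ne_zero
      rw [Ring.choose_eq_smul, Ring.choose_eq_smul, descPochhammer_succ_right,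
        Polynomial.smeval_mul, Polynomial.smeval_sub, Polynomial.smeval_X,
        Polynomial.smeval_natCast, Nat.factorial_succ]
      push_cast
      simp only [smul_eq_mul, pow_one, pow_zero, nsmul_eq_mul, mul_one]
      field_simp
    have hk : (0 : ℝ) < k + 1 := by positivity
    have abs_choose_succ_mul_le :
        |Ring.choose (-e) (k + 1)| * (k + 1) ≤ (k + 1) * (k + 2) := by
      rw [← abs_of_pos hk, ← abs_mul, choose_succ, abs_mul, abs_of_pos hk]
      refine mul_le_mul ih ?_ (abs_nonneg _) hk.le
      rw [abs_le]
      constructor <;> linarith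
    push_cast
    nlinarith

lemma hasSum_choose_mul_pow (a : ℝ) {z : ℝ} (hz : |z| < 1) :
    HasSum (fun k => Ring.choose a k * z ^ k) ((1 + z) ^ a) := by
  have h := (Real.one_add_rpow_hasFPowerSeriesOnBall_zero (a := a)).hasSum (y := z) (by
    simpa [Metric.mem_eball, edist_dist, Real.dist_eq] using hz)
  simpa only [binomialSeries_apply, List.ofFn_const, List.prod_replicate, smul_eq_mul,
    zero_add] using h

lemma hasSum_succ_mul_pow_tail {q : ℝ} (hq₀ : 0 ≤ q) (hq₁ : q < 1) (n : ℕ) :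
    HasSum (fun k : ℕ => ((k + n : ℕ) + 1 : ℝ) * q ^ (k + n))
      (q ^ n * (q / (1 - q) ^ 2 + (n + 1) / (1 - q))) := by
  have linear := hasSum_coe_mul_geometric_of_norm_lt_one
    (by rwa [Real.norm_of_nonneg hq₀] : ‖q‖ < 1)
  have constant := (hasSum_geometric_of_lt_one hq₀ hq₁).mul_left ((n : ℝ) + 1)
  rw [div_eq_mul_inv ((n : ℝ) + 1)]
  refine ((linear.add constant).mul_left (q ^ n)).congr_fun fun k => ?_
  push_cast
  ring

variable {ι κ : Type*}

/-- The combination `∑ i ∈ I, c i * (1 + β i * t) ^ (-e)` of Möbius kernels, as a function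
of `t`. -/
noncomputable def kernelSum (I : Finset ι) (c β : ι → ℝ) (e t : ℝ) : ℝ :=
  ∑ i ∈ I, c i * (1 + β i * t) ^ (-e)

/-- The `k`-th moment of the discrete signed measure with mass `c i` at `β i`. -/
def moment {R : Type*} [Semiring R] (I : Finset ι) (c β : ι → R) (k : ℕ) : R :=
  ∑ i ∈ I, c i * β i ^ k

lemma hasSum_kernelSum {I : Finset ι} {c β : ι → ℝ} {e t : ℝ} (hβ : ∀ i ∈ I, |β i * t| < 1) :
    HasSum (fun k => Ring.choose (-e) k * moment I c β k * t ^ k) (kernelSum I c β e t) := by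
  refine (hasSum_sum fun i hi =>
    (hasSum_choose_mul_pow (-e) (hβ i hi)).mul_left (c i)).congr_fun fun k => ?_
  simp only [moment, Finset.mul_sum, Finset.sum_mul]
  exact Finset.sum_congr rfl fun i _ => by rw [mul_pow]; ring

lemma abs_moment_le {I : Finset ι} {c β : ι → ℝ} {ρ : ℝ} (hβ : ∀ i ∈ I, |β i| ≤ ρ) (k : ℕ) :
    |moment I c β k| ≤ (∑ i ∈ I, |c i|) * ρ ^ k := by
  rw [Finset.sum_mul]
  refine (Finset.abs_sum_le_sum_abs _ _).trans (Finset.sum_le_sum fun i hi => ?_)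
  rw [abs_mul, abs_pow]
  have := hβ i hi
  gcongr

lemma abs_mul_lt_one {β t ρ τ : ℝ} (hρτ : ρ * τ < 1) (hβ : |β| ≤ ρ) (ht : |t| ≤ τ) :
    |β * t| < 1 := by
  rw [abs_mul]
  exact (mul_le_mul hβ ht (abs_nonneg _) ((abs_nonneg _).trans hβ)).trans_lt hρτ

lemma one_add_mul_pos {β t ρ τ : ℝ} (hρτ : ρ * τ < 1) (hβ : |β| ≤ ρ) (ht : |t| ≤ τ) :
    0 < 1 + β * t := by
  linarith [neg_abs_le (β * t), abs_mul_lt_one hρτ hβ ht]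

/-- The gain in mass from the measure `(c, β)` to the measure `(d, γ)` dominates the differences
of their higher moments. For nodes in `[-ρ, ρ]` and `|t| ≤ τ` these differences, weighted by bounds
for the binomial coefficients, control the higher terms of the binomial expansion of the difference
of the kernel sums; those beyond the `N`-th are estimated by the total variation. -/
def MassDominates {R : Type*} [Field R] [LinearOrder R] (ρ τ : R) (N : ℕ) (I : Finset ι)
    (c β : ι → R) (J : Finset κ) (d γ : κ → R) : Prop :=
  ∑ k ∈ Finset.range N,
      (k + 2) * τ ^ (k + 1) * |moment J d γ (k + 1) - moment I c β (k + 1)|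
    + (∑ j ∈ J, |d j| + ∑ i ∈ I, |c i|) *
      ((ρ * τ) ^ (N + 1) * (ρ * τ / (1 - ρ * τ) ^ 2 + (N + 2) / (1 - ρ * τ)))
    ≤ moment J d γ 0 - moment I c β 0

instance (ρ τ : ℚ) (N : ℕ) (I : Finset ι) (c β : ι → ℚ) (J : Finset κ) (d γ : κ → ℚ) :
    Decidable (MassDominates ρ τ N I c β J d γ) :=
  inferInstanceAs (Decidable (_ ≤ _))

lemma MassDominates.cast {ρ τ : ℚ} {N : ℕ} {I : Finset ι} {c β : ι → ℚ} {J : Finset κ}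
    {d γ : κ → ℚ} (h : MassDominates ρ τ N I c β J d γ) :
    MassDominates (ρ : ℝ) τ N I (fun i => (c i : ℝ)) (fun i => (β i : ℝ)) J (fun j => (d j : ℝ))
      (fun j => (γ j : ℝ)) := by
  have h_real := (Rat.cast_le (K := ℝ)).2 h
  simp only [moment] at h_real
  push_cast at h_real
  exact h_real

lemma nonneg_of_hasSum_of_zeroth_dominates {u b B : ℕ → ℝ} {s r : ℝ} (hu : HasSum u s) (N : ℕ)
    (hb : ∀ k < N, |u (k + 1)| ≤ b k) (hB : ∀ k, |u (k + (N + 1))| ≤ B k) (hr : HasSum B r)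
    (h : ∑ k ∈ Finset.range N, b k + r ≤ u 0) : 0 ≤ s := by
  have head_le : |∑ k ∈ Finset.range N, u (k + 1)| ≤ ∑ k ∈ Finset.range N, b k :=
    (Finset.abs_sum_le_sum_abs _ _).trans
      (Finset.sum_le_sum fun k hk => hb k (Finset.mem_range.1 hk))
  have tail_le : |∑' k, u (k + (N + 1))| ≤ r :=
    tsum_of_norm_bounded (f := fun k => u (k + (N + 1))) hr hB
  have split := hu.summable.sum_add_tsum_nat_add (N + 1)
  rw [hu.tsum_eq, Finset.sum_range_succ'] at split
  linarith [neg_abs_le (∑ k ∈ Finset.range N, u (k + 1)),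
    neg_abs_le (∑' k, u (k + (N + 1)))]

theorem kernelSum_le_of_massDominates {ρ τ : ℝ} {N : ℕ} {I : Finset ι} {c β : ι → ℝ}
    {J : Finset κ} {d γ : κ → ℝ} {e t : ℝ} (h : MassDominates ρ τ N I c β J d γ) (he₀ : 0 ≤ e)
    (he₂ : e ≤ 2) (hρ : 0 ≤ ρ) (hρτ : ρ * τ < 1) (hβ : ∀ i ∈ I, |β i| ≤ ρ)
    (hγ : ∀ j ∈ J, |γ j| ≤ ρ) (ht : |t| ≤ τ) :
    kernelSum I c β e t ≤ kernelSum J d γ e t := by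
  have hτ : 0 ≤ τ := (abs_nonneg t).trans ht
  set M : ℕ → ℝ := fun k => moment J d γ k - moment I c β k
  set S : ℝ := ∑ j ∈ J, |d j| + ∑ i ∈ I, |c i|
  have expansion : HasSum (fun k => Ring.choose (-e) k * M k * t ^ k)
      (kernelSum J d γ e t - kernelSum I c β e t) :=
    ((hasSum_kernelSum fun j hj => abs_mul_lt_one hρτ (hγ j hj) ht).sub
      (hasSum_kernelSum fun i hi => abs_mul_lt_one hρτ (hβ i hi) ht)).congr_fun
      fun k => by simp only [M]; ring
  have abs_term_le (k : ℕ) : |Ring.choose (-e) k * M k * t ^ k| ≤ (k + 1) * τ ^ k * |M k| := by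
    rw [abs_mul, abs_mul, abs_pow, mul_right_comm]
    gcongr
    exact abs_choose_neg_le he₀ he₂ k
  have abs_moment_diff_le (k : ℕ) : |M k| ≤ S * ρ ^ k := by
    refine (abs_sub _ _).trans ?_
    rw [add_mul]
    exact add_le_add (abs_moment_le hγ _) (abs_moment_le hβ _)
  have head_le : ∀ k < N, |Ring.choose (-e) (k + 1) * M (k + 1) * t ^ (k + 1)| ≤
      (k + 2) * τ ^ (k + 1) * |M (k + 1)| := fun k _ =>
    (abs_term_le (k + 1)).trans_eq (by push_cast; ring)
  have tail_le (k : ℕ) :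
      |Ring.choose (-e) (k + (N + 1)) * M (k + (N + 1)) * t ^ (k + (N + 1))| ≤
        S * (((k + (N + 1) : ℕ) + 1) * (ρ * τ) ^ (k + (N + 1))) := by
    refine (abs_term_le _).trans ((mul_le_mul_of_nonneg_left (abs_moment_diff_le _)
      (by positivity)).trans_eq ?_)
    rw [mul_pow]
    ring
  have tail_sum := (hasSum_succ_mul_pow_tail (mul_nonneg hρ hτ) hρτ (N + 1)).mul_left S
  push_cast [add_assoc, one_add_one_eq_two] at tail_sum tail_le
  exact sub_nonneg.1 (nonneg_of_hasSum_of_zeroth_dominates expansion N head_le tail_le tail_sum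
    (by simpa [M, MassDominates] using h))

end Moments

section LogBounds

/-- The lower bound for `log u` given by `n` terms of the series of `2 * artanh z`, where
`z = (u - 1) / (u + 1)`. -/
def logLower {R : Type*} [Field R] (u : R) (n : ℕ) : R :=
  2 * ∑ i ∈ Finset.range n, ((u - 1) / (u + 1)) ^ (2 * i + 1) / (2 * i + 1)

/-- The upper bound for `log u` that adds to `logLower u n` a geometric majorant of the remainder
of the series. -/
def logUpper {R : Type*} [Field R] (u : R) (n : ℕ) : R :=
  logLower u n + 2 * (((u - 1) / (u + 1)) ^ (2 * n + 1) / (1 - ((u - 1) / (u + 1)) ^ 2))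

lemma cast_logLower (u : ℚ) (n : ℕ) : ((logLower u n : ℚ) : ℝ) = logLower (u : ℝ) n := by
  simp [logLower]

lemma cast_logUpper (u : ℚ) (n : ℕ) : ((logUpper u n : ℚ) : ℝ) = logUpper (u : ℝ) n := by
  simp [logUpper, cast_logLower]

lemma cayley_mem_Ico {u : ℝ} (hu : 1 ≤ u) : (u - 1) / (u + 1) ∈ Set.Ico (0 : ℝ) 1 :=
  ⟨div_nonneg (by linarith) (by linarith), by rw [div_lt_one (by linarith)]; linarith⟩

lemma one_add_cayley_div_one_sub_cayley {u : ℝ} (hu : u + 1 ≠ 0) :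
    (1 + (u - 1) / (u + 1)) / (1 - (u - 1) / (u + 1)) = u := by
  field_simp
  ring

lemma logLower_le_log {u : ℝ} (hu : 1 ≤ u) (n : ℕ) : logLower u n ≤ Real.log u := by
  have hz := cayley_mem_Ico hu
  have h := Real.sum_range_le_log_div hz.1 hz.2 n
  rw [one_add_cayley_div_one_sub_cayley (by linarith)] at h
  unfold logLower
  linarith

lemma log_le_logUpper {u : ℝ} (hu : 1 ≤ u) (n : ℕ) : Real.log u ≤ logUpper u n := by
  have hz := cayley_mem_Ico hu
  have h := Real.log_div_le_sum_range_add hz.1 hz.2 n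
  rw [one_add_cayley_div_one_sub_cayley (by linarith)] at h
  unfold logUpper logLower
  linarith

lemma rpow_neg_le_of_logUpper_le {a v e : ℚ} (n : ℕ) (ha : 1 ≤ a) (hv₀ : 0 < v) (hv₁ : v ≤ 1)
    (he : 0 ≤ e) (h : logUpper v⁻¹ n ≤ e * logLower a n) : (a : ℝ) ^ (-(e : ℝ)) ≤ v := by
  rify at ha hv₀ hv₁ he h
  rw [cast_logUpper, cast_logLower, Rat.cast_inv] at h
  have log_inv_le := log_le_logUpper ((one_le_inv₀ hv₀).2 hv₁) n
  have le_log := mul_le_mul_of_nonneg_left (logLower_le_log ha n) he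
  rw [Real.log_inv] at log_inv_le
  rw [← Real.log_le_log_iff (by positivity) hv₀, Real.log_rpow (by linarith)]
  linarith

lemma le_rpow_neg_of_le_logLower {a v e : ℚ} (n : ℕ) (ha : 1 ≤ a) (hv₀ : 0 < v) (hv₁ : v ≤ 1)
    (he : 0 ≤ e) (h : e * logUpper a n ≤ logLower v⁻¹ n) : (v : ℝ) ≤ (a : ℝ) ^ (-(e : ℝ)) := by
  rify at ha hv₀ hv₁ he h
  rw [cast_logUpper, cast_logLower, Rat.cast_inv] at h
  have le_log_inv := logLower_le_log ((one_le_inv₀ hv₀).2 hv₁) n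
  have log_le := mul_le_mul_of_nonneg_left (log_le_logUpper ha n) he
  rw [Real.log_inv] at le_log_inv
  rw [← Real.log_le_log_iff hv₀ (by positivity), Real.log_rpow (by linarith)]
  linarith

end LogBounds

section Kernels

/-- The value at `x = 1 / 2` of the affine function `(x + a) * (1 + β * (1 / (x + a) - 1 / 2))`,
whose slope is `1 - β / 2`. -/
def branchShift {R : Type*} [Field R] (β : R) (a : ℕ) : R := (1 - β / 2) * (a + 1 / 2) + β

/-- The node of the Möbius kernel to which the branch with digit `a` transfers the kernel with
node `β`. -/
def branchNode {R : Type*} [Field R] (β : R) (a : ℕ) : R := (1 - β / 2) / branchShift β a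

lemma cast_branchShift (β : ℚ) (a : ℕ) :
    ((branchShift β a : ℚ) : ℝ) = branchShift (β : ℝ) a := by
  simp [branchShift]

lemma cast_branchNode (β : ℚ) (a : ℕ) : ((branchNode β a : ℚ) : ℝ) = branchNode (β : ℝ) a := by
  simp [branchNode, cast_branchShift]

lemma branchShift_pos {β : ℝ} (hβ₀ : 0 ≤ β) (hβ₂ : β < 2) (a : ℕ) : 0 < branchShift β a :=
  add_pos_of_pos_of_nonneg (mul_pos (by linarith) (by positivity)) hβ₀

lemma branchNode_nonneg {β : ℝ} (hβ₀ : 0 ≤ β) (hβ₂ : β < 2) (a : ℕ) : 0 ≤ branchNode β a :=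
  div_nonneg (by linarith) (branchShift_pos hβ₀ hβ₂ a).le

lemma branchNode_le {β : ℝ} (hβ₀ : 0 ≤ β) (hβ₂ : β < 2) {a : ℕ} (ha : 1 ≤ a) :
    branchNode β a ≤ 2 / 3 := by
  have one_le : (1 : ℝ) ≤ a := Nat.one_le_cast.2 ha
  rw [branchNode, div_le_iff₀ (branchShift_pos hβ₀ hβ₂ a), branchShift]
  nlinarith

lemma abs_le_two_thirds {β : ℝ} (hβ : β ∈ Set.Icc (0 : ℝ) (2 / 3)) : |β| ≤ 2 / 3 :=
  (abs_of_nonneg hβ.1).trans_le hβ.2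

lemma branchNode_mem_Icc {β : ℝ} (hβ : β ∈ Set.Icc (0 : ℝ) (2 / 3)) {a : ℕ} (ha : 1 ≤ a) :
    branchNode β a ∈ Set.Icc (0 : ℝ) (2 / 3) :=
  ⟨branchNode_nonneg hβ.1 (by linarith [hβ.2]) a, branchNode_le hβ.1 (by linarith [hβ.2]) ha⟩

lemma abs_sub_half_le {x : ℝ} (hx : x ∈ Set.Icc (0 : ℝ) 1) : |x - 1 / 2| ≤ 1 / 2 :=
  abs_le.2 ⟨by linarith [hx.1], by linarith [hx.2]⟩

lemma branch_kernel {β x : ℝ} {a : ℕ} (e : ℝ) (hβ₀ : 0 ≤ β) (hβ₂ : β < 2)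
    (hxa : 0 < x + a) :
    (x + a) ^ (-e) * (1 + β * (gaussBranch a x - 1 / 2)) ^ (-e) =
      branchShift β a ^ (-e) * (1 + branchNode β a * (x - 1 / 2)) ^ (-e) := by
  have shift_pos := branchShift_pos hβ₀ hβ₂ a
  have eq_affine : (x + a) * (1 + β * (gaussBranch a x - 1 / 2)) =
      (1 - β / 2) * (x + a) + β := by
    rw [gaussBranch]
    field_simp
    ring
  have affine_eq : branchShift β a * (1 + branchNode β a * (x - 1 / 2)) =
      (1 - β / 2) * (x + a) + β := by
    rw [branchNode, mul_one_add, ← mul_assoc, mul_div_cancel₀ _ shift_pos.ne', branchShift]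
    ring
  have affine_pos : 0 < (1 - β / 2) * (x + a) + β :=
    add_pos_of_pos_of_nonneg (mul_pos (by linarith) hxa) hβ₀
  rw [← Real.mul_rpow hxa.le (pos_of_mul_pos_right (eq_affine ▸ affine_pos) hxa.le).le,
    ← Real.mul_rpow shift_pos.le (pos_of_mul_pos_right (affine_eq ▸ affine_pos) shift_pos.le).le,
    eq_affine, affine_eq]

variable {ι : Type*}

lemma gaussTransfer_kernelSum {A : Finset ℕ} (hA : 0 ∉ A) {J : Finset ι} {β : ι → ℝ}
    (hβ₀ : ∀ j ∈ J, 0 ≤ β j) (hβ₂ : ∀ j ∈ J, β j < 2) (c : ι → ℝ) (e : ℝ) {x : ℝ} (hx : 0 ≤ x) :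
    gaussTransfer A e (fun y => kernelSum J c β e (y - 1 / 2)) x =
      kernelSum (J ×ˢ A) (fun p => c p.1 * branchShift (β p.1) p.2 ^ (-e))
        (fun p => branchNode (β p.1) p.2) e (x - 1 / 2) := by
  simp only [gaussTransfer, kernelSum, Finset.sum_product_right, Finset.mul_sum]
  refine Finset.sum_congr rfl fun a ha => Finset.sum_congr rfl fun j hj => ?_
  have a_pos : (0 : ℝ) < a := Nat.cast_pos.2 (Nat.pos_of_ne_zero (ne_of_mem_of_not_mem ha hA))
  rw [mul_left_comm, branch_kernel e (hβ₀ j hj) (hβ₂ j hj) (by positivity), mul_assoc]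

lemma kernelSum_le_kernelSum {I : Finset ι} {c d β : ι → ℝ} {t : ℝ} (e : ℝ)
    (hcd : ∀ i ∈ I, c i ≤ d i) (hβ : ∀ i ∈ I, 0 ≤ 1 + β i * t) :
    kernelSum I c β e t ≤ kernelSum I d β e t :=
  Finset.sum_le_sum fun i hi =>
    mul_le_mul_of_nonneg_right (hcd i hi) (Real.rpow_nonneg (hβ i hi) _)

lemma kernelSum_pos {I : Finset ι} (hI : I.Nonempty) {c β : ι → ℝ} {t : ℝ} (e : ℝ)
    (hc : ∀ i ∈ I, 0 < c i) (hβ : ∀ i ∈ I, 0 < 1 + β i * t) : 0 < kernelSum I c β e t :=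
  Finset.sum_pos (fun i hi => mul_pos (hc i hi) (Real.rpow_pos_of_pos (hβ i hi) _)) hI

lemma continuousOn_kernelSum {I : Finset ι} {c β : ι → ℝ} {s : Set ℝ} (e : ℝ)
    (hβ : ∀ i ∈ I, ∀ t ∈ s, 1 + β i * t ≠ 0) : ContinuousOn (kernelSum I c β e) s :=
  continuousOn_finsetSum _ fun i hi => continuousOn_const.mul
    (ContinuousOn.rpow_const (by fun_prop) fun t ht => Or.inl (hβ i hi t ht))

end Kernels

section TransferBounds

variable {ι : Type*} {A : Finset ℕ} {J : Finset ι} {c β : ι → ℝ} {P : ι → ℕ → ℝ} {e : ℝ} {N : ℕ}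

theorem gaussTransfer_kernelSum_le (hA : 0 ∉ A) (hβ : ∀ j ∈ J, β j ∈ Set.Icc (0 : ℝ) (2 / 3))
    (hc : ∀ j ∈ J, 0 ≤ c j) (he₀ : 0 ≤ e) (he₂ : e ≤ 2)
    (hP : ∀ j ∈ J, ∀ a ∈ A, branchShift (β j) a ^ (-e) ≤ P j a)
    (hM : MassDominates (2 / 3) (1 / 2) N (J ×ˢ A) (fun p => c p.1 * P p.1 p.2)
      (fun p => branchNode (β p.1) p.2) J c β) {x : ℝ} (hx : x ∈ Set.Icc (0 : ℝ) 1) :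
    gaussTransfer A e (fun y => kernelSum J c β e (y - 1 / 2)) x ≤
      kernelSum J c β e (x - 1 / 2) := by
  have abs_node_le (p : ι × ℕ) (hp : p ∈ J ×ˢ A) : |branchNode (β p.1) p.2| ≤ 2 / 3 := by
    obtain ⟨hj, ha⟩ := Finset.mem_product.1 hp
    exact abs_le_two_thirds
      (branchNode_mem_Icc (hβ _ hj) (Nat.one_le_iff_ne_zero.2 (ne_of_mem_of_not_mem ha hA)))
  rw [gaussTransfer_kernelSum hA (fun j hj => (hβ j hj).1)
    (fun j hj => (hβ j hj).2.trans_lt (by norm_num)) c e hx.1]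
  refine (kernelSum_le_kernelSum e (fun p hp => ?_) fun p hp =>
    (one_add_mul_pos (by norm_num) (abs_node_le p hp) (abs_sub_half_le hx)).le).trans
    (kernelSum_le_of_massDominates hM he₀ he₂ (by norm_num) (by norm_num) abs_node_le
      (fun j hj => abs_le_two_thirds (hβ j hj)) (abs_sub_half_le hx))
  obtain ⟨hj, ha⟩ := Finset.mem_product.1 hp
  exact mul_le_mul_of_nonneg_left (hP _ hj _ ha) (hc _ hj)

theorem le_gaussTransfer_kernelSum (hA : 0 ∉ A) (hβ : ∀ j ∈ J, β j ∈ Set.Icc (0 : ℝ) (2 / 3))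
    (hc : ∀ j ∈ J, 0 ≤ c j) (he₀ : 0 ≤ e) (he₂ : e ≤ 2)
    (hP : ∀ j ∈ J, ∀ a ∈ A, P j a ≤ branchShift (β j) a ^ (-e))
    (hM : MassDominates (2 / 3) (1 / 2) N J c β (J ×ˢ A) (fun p => c p.1 * P p.1 p.2)
      (fun p => branchNode (β p.1) p.2)) {x : ℝ} (hx : x ∈ Set.Icc (0 : ℝ) 1) :
    kernelSum J c β e (x - 1 / 2) ≤
      gaussTransfer A e (fun y => kernelSum J c β e (y - 1 / 2)) x := by
  have abs_node_le (p : ι × ℕ) (hp : p ∈ J ×ˢ A) : |branchNode (β p.1) p.2| ≤ 2 / 3 := by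
    obtain ⟨hj, ha⟩ := Finset.mem_product.1 hp
    exact abs_le_two_thirds
      (branchNode_mem_Icc (hβ _ hj) (Nat.one_le_iff_ne_zero.2 (ne_of_mem_of_not_mem ha hA)))
  rw [gaussTransfer_kernelSum hA (fun j hj => (hβ j hj).1)
    (fun j hj => (hβ j hj).2.trans_lt (by norm_num)) c e hx.1]
  refine (kernelSum_le_of_massDominates hM he₀ he₂ (by norm_num) (by norm_num)
    (fun j hj => abs_le_two_thirds (hβ j hj)) abs_node_le (abs_sub_half_le hx)).trans
    (kernelSum_le_kernelSum e (fun p hp => ?_) fun p hp =>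
      (one_add_mul_pos (by norm_num) (abs_node_le p hp) (abs_sub_half_le hx)).le)
  obtain ⟨hj, ha⟩ := Finset.mem_product.1 hp
  exact mul_le_mul_of_nonneg_left (hP _ hj _ ha) (hc _ hj)

end TransferBounds

section Digits1235

/-- The nodes of the approximate eigenfunction for the digits `1, 2, 3, 5`, found numerically so
that for the coefficients `approxCoeff` the moments beyond the first eight are nearly invariant as
well. -/
def approxNode : Fin 8 → ℚ :=
  ![0.164608, 0.232672, 0.285777, 0.351230, 0.454330, 0.516295, 0.558425, 0.595071]

/-- The coefficients of the approximate eigenfunction for the digits `1, 2, 3, 5`: up to rounding,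
they make the first eight moments invariant under the transfer operator at the exponent for which
its leading eigenvalue is `1`. -/
def approxCoeff : Fin 8 → ℚ :=
  ![0.08316751786384, 0.09944439004672, 0.15476607457510, 0.18175104387322,
    0.19031632435247, 0.14215925764771, 0.10308352679986, 0.04531186484109]

/-- Rounded values, at the exponent `e` of `approxCoeff`, of
`branchShift (approxNode j) a ^ (-e)` for the digits `a = 1, 2, 3, 5` (`0` is a dummy value at
other digits). -/
def approxPower (j : Fin 8) : ℕ → ℚ
  | 1 => ![0.51330351123822, 0.50468633544781, 0.49812732984084, 0.49023450604354,
      0.47821297730753, 0.47121968588016, 0.46656066583482, 0.46256952674174] j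
  | 2 => ![0.24978031953298, 0.25246909554808, 0.25460024650402, 0.25726802309188,
      0.26156478566043, 0.26420446672873, 0.26602436854088, 0.26762424654283] j
  | 3 => ![0.15317413705459, 0.15681448046327, 0.15975495210005, 0.16350617066519,
      0.16971723214800, 0.17363980454193, 0.17639291884347, 0.17884669962793] j
  | 5 => ![0.07843491019396, 0.08128118039964, 0.08362225220070, 0.08666433205451,
      0.09184140091751, 0.09520334718396, 0.09760673596715, 0.09977976333020] j
  | _ => 0

/-- The rounded powers with a relative perturbation `δ`: a small margin makes them one-sided bounds
for the exact powers at exponents slightly above or below that of `approxCoeff`. -/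
def perturbedPower (δ : ℚ) (j : Fin 8) (a : ℕ) : ℚ := approxPower j a * (1 + δ)

lemma approxNode_mem_Icc : ∀ j, approxNode j ∈ Set.Icc 0 (2 / 3) := by
  simp only [Set.mem_Icc]
  decide +kernel

lemma cast_approxNode_mem_Icc (j : Fin 8) : (approxNode j : ℝ) ∈ Set.Icc (0 : ℝ) (2 / 3) := by
  have h := approxNode_mem_Icc j
  rify [Set.mem_Icc] at h
  exact h

lemma approxCoeff_pos : ∀ j, 0 < approxCoeff j := by
  decide +kernel

lemma one_le_branchShift_approxNode : ∀ j, ∀ a ∈ ({1, 2, 3, 5} : Finset ℕ),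
    1 ≤ branchShift (approxNode j) a := by
  decide +kernel

lemma perturbedPower_neg_pos_and_le_one : ∀ j, ∀ a ∈ ({1, 2, 3, 5} : Finset ℕ),
    0 < perturbedPower (-4 / 10 ^ 13) j a ∧ perturbedPower (-4 / 10 ^ 13) j a ≤ 1 := by
  decide +kernel

lemma perturbedPower_pos_and_le_one : ∀ j, ∀ a ∈ ({1, 2, 3, 5} : Finset ℕ),
    0 < perturbedPower (4 / 10 ^ 13) j a ∧ perturbedPower (4 / 10 ^ 13) j a ≤ 1 := by
  decide +kernel

lemma logUpper_inv_perturbedPower_le : ∀ j, ∀ a ∈ ({1, 2, 3, 5} : Finset ℕ),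
    logUpper (perturbedPower (-4 / 10 ^ 13) j a)⁻¹ 120 ≤
      2 * 0.770914939939 * logLower (branchShift (approxNode j) a) 120 := by
  decide +kernel

lemma mul_logUpper_le_logLower_inv_perturbedPower : ∀ j, ∀ a ∈ ({1, 2, 3, 5} : Finset ℕ),
    2 * 0.770914939936 * logUpper (branchShift (approxNode j) a) 120 ≤
      logLower (perturbedPower (4 / 10 ^ 13) j a)⁻¹ 120 := by
  decide +kernel

lemma massDominates_perturbedPower_neg :
    MassDominates (2 / 3) (1 / 2) 36 (Finset.univ ×ˢ {1, 2, 3, 5})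
      (fun p => approxCoeff p.1 * perturbedPower (-4 / 10 ^ 13) p.1 p.2)
      (fun p => branchNode (approxNode p.1) p.2) Finset.univ approxCoeff approxNode := by
  decide +kernel

lemma massDominates_perturbedPower :
    MassDominates (2 / 3) (1 / 2) 36 Finset.univ approxCoeff approxNode
      (Finset.univ ×ˢ {1, 2, 3, 5})
      (fun p => approxCoeff p.1 * perturbedPower (4 / 10 ^ 13) p.1 p.2)
      (fun p => branchNode (approxNode p.1) p.2) := by
  decide +kernel

/-- The approximate leading eigenfunction of the transfer operator with digits `1, 2, 3, 5` and
exponent `e`, accurate for `e` near the exponent of `approxCoeff`. -/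
noncomputable def approxEigenfun (e x : ℝ) : ℝ :=
  kernelSum Finset.univ (fun j => (approxCoeff j : ℝ)) (fun j => (approxNode j : ℝ)) e (x - 1 / 2)

lemma one_add_approxNode_mul_pos (j : Fin 8) {x : ℝ} (hx : x ∈ Set.Icc (0 : ℝ) 1) :
    0 < 1 + (approxNode j : ℝ) * (x - 1 / 2) :=
  one_add_mul_pos (by norm_num) (abs_le_two_thirds (cast_approxNode_mem_Icc j))
    (abs_sub_half_le hx)

lemma approxEigenfun_pos (e : ℝ) {x : ℝ} (hx : x ∈ Set.Icc (0 : ℝ) 1) : 0 < approxEigenfun e x :=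
  kernelSum_pos Finset.univ_nonempty e (fun j _ => Rat.cast_pos.2 (approxCoeff_pos j))
    fun j _ => one_add_approxNode_mul_pos j hx

lemma continuousOn_approxEigenfun (e : ℝ) : ContinuousOn (approxEigenfun e) (Set.Icc 0 1) :=
  (continuousOn_kernelSum (s := (· - 1 / 2) '' Set.Icc 0 1) e fun j _ =>
    Set.forall_mem_image.2 fun _ hx => (one_add_approxNode_mul_pos j hx).ne').comp
    (by fun_prop) (Set.mapsTo_image _ _)

lemma gaussTransfer_approxEigenfun_le {x : ℝ} (hx : x ∈ Set.Icc (0 : ℝ) 1) :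
    gaussTransfer {1, 2, 3, 5} (2 * 0.770914939939) (approxEigenfun (2 * 0.770914939939)) x ≤
      approxEigenfun (2 * 0.770914939939) x := by
  have power_le : ∀ j ∈ Finset.univ, ∀ a ∈ ({1, 2, 3, 5} : Finset ℕ),
      branchShift (approxNode j : ℝ) a ^ (-(2 * 0.770914939939 : ℝ)) ≤
        perturbedPower (-4 / 10 ^ 13) j a := fun j _ a ha => by
    have range := perturbedPower_neg_pos_and_le_one j a ha
    have bound := rpow_neg_le_of_logUpper_le 120 (one_le_branchShift_approxNode j a ha)
      range.1 range.2 (by norm_num) (logUpper_inv_perturbedPower_le j a ha)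
    push_cast [cast_branchShift] at bound
    exact bound
  have moments := massDominates_perturbedPower_neg.cast
  push_cast [cast_branchNode] at moments
  exact gaussTransfer_kernelSum_le (by simp) (fun j _ => cast_approxNode_mem_Icc j)
    (fun j _ => (Rat.cast_pos.2 (approxCoeff_pos j)).le) (by norm_num) (by norm_num) power_le
    moments hx

lemma approxEigenfun_le_gaussTransfer {x : ℝ} (hx : x ∈ Set.Icc (0 : ℝ) 1) :
    approxEigenfun (2 * 0.770914939936) x ≤
      gaussTransfer {1, 2, 3, 5} (2 * 0.770914939936) (approxEigenfun (2 * 0.770914939936)) x := by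
  have le_power : ∀ j ∈ Finset.univ, ∀ a ∈ ({1, 2, 3, 5} : Finset ℕ),
      (perturbedPower (4 / 10 ^ 13) j a : ℝ) ≤
        branchShift (approxNode j : ℝ) a ^ (-(2 * 0.770914939936 : ℝ)) := fun j _ a ha => by
    have range := perturbedPower_pos_and_le_one j a ha
    have bound := le_rpow_neg_of_le_logLower 120 (one_le_branchShift_approxNode j a ha)
      range.1 range.2 (by norm_num) (mul_logUpper_le_logLower_inv_perturbedPower j a ha)
    push_cast [cast_branchShift] at bound
    exact bound
  have moments := massDominates_perturbedPower.cast
  push_cast [cast_branchNode] at moments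
  exact le_gaussTransfer_kernelSum (by simp) (fun j _ => cast_approxNode_mem_Icc j)
    (fun j _ => (Rat.cast_pos.2 (approxCoeff_pos j)).le) (by norm_num) (by norm_num) le_power
    moments hx

theorem dimH_gaussLimitSet_1235_le :
    dimH (gaussLimitSet {1, 2, 3, 5}) ≤ ENNReal.ofReal 0.770914939939 :=
  dimH_gaussLimitSet_le (by simp) (by norm_num) (continuousOn_approxEigenfun _)
    (fun _ => approxEigenfun_pos _) fun _ => gaussTransfer_approxEigenfun_le

theorem le_dimH_gaussLimitSet_1235 :
    ENNReal.ofReal 0.770914939936 ≤ dimH (gaussLimitSet {1, 2, 3, 5}) :=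
  le_dimH_gaussLimitSet (by simp) (continuousOn_approxEigenfun _)
    (fun _ => approxEigenfun_pos _) fun _ => approxEigenfun_le_gaussTransfer

end Digits1235

theorem mainTheorem8 :
    |(dimH (gaussLimitSet {1, 2, 3, 5})).toReal - 0.7709149399375| ≤ 1.5 * (10 : ℝ) ^ (-12 : ℤ) ∧
      3 - Real.sqrt 5 < (dimH (gaussLimitSet {1, 2, 3, 5})).toReal := by
  have ne_top := ne_top_of_le_ne_top ENNReal.ofReal_ne_top dimH_gaussLimitSet_1235_le
  have upper := ENNReal.toReal_le_of_le_ofReal (by norm_num) dimH_gaussLimitSet_1235_le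
  have lower := (ENNReal.ofReal_le_iff_le_toReal ne_top).1 le_dimH_gaussLimitSet_1235
  have lt_sqrt_five : 2.23 < Real.sqrt 5 := Real.lt_sqrt_of_sq_lt (by norm_num)
  refine ⟨?_, by linarith⟩
  rw [show (10 : ℝ) ^ (-12 : ℤ) = 1 / 10 ^ 12 by norm_num, abs_le]
  constructor <;> linarith
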